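/- Let $G$ be a finite connected graph (parallel edges and self-loops allowed) with vertex set $V$, internal edges $e\in E$ and exactly two external edges, attached to vertices $a$ and $b$ (possibly equal). All lines are massless. Let $D\in\mathbb{C}$ with $\operatorname{Re}D>0$, and let $\beta_e\in\mathbb{C}$ with $\operatorname{Re}\beta_e>0$ for $e\in E$. For a connected graph $H$ with internal edge set $E_H$ put $$U_H(\alpha)=\sum_{T}\prod_{e\notin T}\alpha_e,$$ the sum over the spanning trees $T$ of $H$ (first Symanzik polynomial). Let $\mathcal V_G(\alpha)=p^2\sum_{F}\prod_{e\notin F}\alpha_e$, the sum over the spanning $2$-forests $F$ of $G$ that have $a$ and $b$ in different trees (second Symanzik polynomial), and let $\mathcal V_H=0$ if $H$ has no external edges. The Feynman integral of $G$ at external momentum squared $p^2>0$ is given by its Schwinger representation $$I_G(p^2)=\int_{(0,\infty)^{E}}\Big(\prod_{e\in E}\frac{\alpha_e^{\beta_e-1}}{\Gamma(\beta_e)}\,d\alpha_e\Big)\,U_G^{-D/2}\exp\!\Big(-\frac{\mathcal V_G}{U_G}\Big),$$ which is assumed to converge absolutely for every $p^2>0$. Assume that $$I_G(p^2)=(p^2)^{\beta_0-D/2}\,\mathcal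 N\qquad\text{for all }p^2>0,$$ for some $\mathcal N=\mathcal N(\{\beta_e\})\in\mathbb{C}$ and some $\beta_0\in\mathbb{C}$ with $\operatorname{Re}\beta_0>0$. (If $\mathcal N=0$, so that this relation does not determine $\beta_0$, assume in addition that $\beta_0+\sum_{e\in E}\beta_e=\frac D2\,(|E|-|V|+2)$, i.e. that $\beta_0$ is the exponent that makes the integral of the graph $\tilde G$ below scale invariant.) Let $\tilde G$ be the vacuum graph obtained from $G$ by joining its two external edges into one new internal edge, labelled $0$, between $a$ and $b$, with exponent $\beta_0$. For a nonempty set $\mathcal J\subseteq\{0\}\cup E$ of internal edges of $\tilde G$ let $$I^{(r)}_{\tilde G}=\int_{(0,\infty)^{\{0\}\cup E}}\Big(\prod_{e\in\{0\}\cup E}\frac{\alpha_e^{\beta_e-1}}{\Gamma(\beta_e)}\,d\alpha_e\Big)\,\delta\Big(1-\sum_{i\in\mathcal J}\alpha_i\Big)\,U_{\tilde G}^{-D/2}$$ be the reduced Feynman integral, where the delta function is used to integrate out one of the variables $\alpha_j$, $j\in\mathcal J$. Then, for every nonempty $\mathcal J$ and every $j\in\mathcal J$, the integral $I^{(r)}_{\tilde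 G}$ converges absolutely, and $$\mathcal N(\{\beta_e\})=\Gamma(D/2)\,I^{(r)}_{\tilde G}.$$ In particular $I^{(r)}_{\tilde G}$ does not depend on the choice of $\mathcal J$ and $j$. -/

import Mathlib

open MeasureTheory

/-- A (multi)graph with vertices `V`, internal edges `E` (unordered pairs of vertices; parallel edges
and self-loops are allowed) and external edges `X`, each attached to one vertex. -/
structure FeynmanGraph (V E X : Type*) where
  /-- the two ends of an internal edge -/
  ends : E → Sym2 V
  /-- the vertex to which an external edge is attached -/
  leg : X → V

namespace FeynmanGraph

variable {V E X : Type*}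

/-- The simple graph that records which vertices are neighbours through the edges in `T`. It is
used for connectivity only. -/
def skeleton (G : FeynmanGraph V E X) (T : Set E) : SimpleGraph V :=
  SimpleGraph.fromRel fun u v => ∃ e ∈ T, G.ends e = s(u, v)

/-- `u` and `v` are joined by a path that runs through edges in `T`. -/
def Joined (G : FeynmanGraph V E X) (T : Set E) (u v : V) : Prop :=
  (G.skeleton T).Reachable u v

/-- The graph is connected. -/
def IsConnected (G : FeynmanGraph V E X) : Prop :=
  (G.skeleton Set.univ).Connected

/-- The spanning subgraph with edge set `T` is a forest: it has no cycle, that is, deleting any of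
its edges separates the ends of that edge. (So `T` contains no self-loop and no two
parallel edges.) -/
def IsForest (G : FeynmanGraph V E X) (T : Set E) : Prop :=
  ∀ e ∈ T, ∀ u v : V, G.ends e = s(u, v) → ¬ G.Joined (T \ {e}) u v

/-- The spanning subgraph with edge set `T` is a spanning `n`-forest: a disjoint union of `n`
nonempty trees that contains all vertices (a tree may be a single vertex). A spanning tree is a
spanning `1`-forest. -/
def IsSpanningForest (G : FeynmanGraph V E X) (n : ℕ) (T : Set E) : Prop :=
  G.IsForest T ∧ Nat.card (G.skeleton T).ConnectedComponent = n

open Classical in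
/-- The finite set of all spanning `n`-forests, given by their sets of edges. -/
noncomputable def spanningForests [Fintype E] (G : FeynmanGraph V E X) (n : ℕ) :
    Finset (Finset E) :=
  Finset.filter (fun T : Finset E => G.IsSpanningForest n (T : Set E)) Finset.univ

open Classical in
/-- First Symanzik polynomial: the sum over the spanning trees `T` of `∏_{e ∉ T} α_e`. -/
noncomputable def firstSymanzik [Fintype E] (G : FeynmanGraph V E X) (α : E → ℝ) : ℝ :=
  ∑ T ∈ G.spanningForests 1, ∏ e ∈ Finset.univ \ T, α e

open Classical in
/-- Second Symanzik polynomial of a massless graph: the sum over the spanning `2`-forests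
`{T₁, T₂}` of `∏_{e ∉ T₁ ∪ T₂} α_e` times the sum of the scalar products `s x y = p_x · p_y` over
the external edges `x` attached to `T₁` and `y` attached to `T₂`. The sum over `x, y` below meets each
such pair in both orders, whence the factor `1 / 2`. -/
noncomputable def secondSymanzik [Fintype E] [Fintype X] (G : FeynmanGraph V E X)
    (s : X → X → ℝ) (α : E → ℝ) : ℝ :=
  ∑ T ∈ G.spanningForests 2,
    (∏ e ∈ Finset.univ \ T, α e) *
      ((1 / 2) * ∑ x : X, ∑ y : X,
        if G.Joined (T : Set E) (G.leg x) (G.leg y) then 0 else s x y)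

/-- The integrand `(∏_e α_e^{β_e - 1} / Γ(β_e)) U^{-D/2} exp(-V / U)` of the Schwinger
representation in dimension `D`. -/
noncomputable def schwingerIntegrand [Fintype E] [Fintype X] (G : FeynmanGraph V E X) (D : ℂ)
    (β : E → ℂ) (s : X → X → ℝ) (α : E → ℝ) : ℂ :=
  (∏ e, (α e : ℂ) ^ (β e - 1) / Complex.Gamma (β e)) *
    (G.firstSymanzik α : ℂ) ^ (-(D / 2)) *
    Complex.exp (-((G.secondSymanzik s α : ℂ) / (G.firstSymanzik α : ℂ)))

/-- The Schwinger integral over all `α_e > 0` converges absolutely. -/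
def IntegralConverges [Fintype E] [Fintype X] (G : FeynmanGraph V E X) (D : ℂ)
    (β : E → ℂ) (s : X → X → ℝ) : Prop :=
  IntegrableOn (G.schwingerIntegrand D β s) {α : E → ℝ | ∀ e, 0 < α e}

/-- The Feynman integral in the Schwinger representation. -/
noncomputable def feynmanIntegral [Fintype E] [Fintype X] (G : FeynmanGraph V E X) (D : ℂ)
    (β : E → ℂ) (s : X → X → ℝ) : ℂ :=
  ∫ α in {α : E → ℝ | ∀ e, 0 < α e}, G.schwingerIntegrand D β s α

/-- For `j ∈ J`: the point of the hyperplane `∑_{i ∈ J} α_i = 1` whose coordinates other than the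
`j`-th are the given ones. -/
def deltaPoint [Fintype E] [DecidableEq E] (J : Finset E) (j : E) (α : {e : E // e ≠ j} → ℝ) :
    E → ℝ :=
  fun e => if h : e = j then 1 - ∑ i : {e : E // e ≠ j}, (if (i : E) ∈ J then α i else 0)
    else α ⟨e, h⟩

/-- The reduced integral, with `δ(1 - ∑_{i ∈ J} α_i)` used to integrate out `α_j` (`j ∈ J`),
converges absolutely. -/
def ReducedIntegralConverges [Fintype E] [DecidableEq E] [Fintype X] (G : FeynmanGraph V E X)
    (D : ℂ) (β : E → ℂ) (s : X → X → ℝ) (J : Finset E) (j : E) : Prop :=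
  IntegrableOn (fun α => G.schwingerIntegrand D β s (deltaPoint J j α))
    {α : {e : E // e ≠ j} → ℝ | ∀ e, 0 < deltaPoint J j α e}

/-- The reduced integral: the Schwinger integral over all `α_e > 0` with the additional factor
`δ(1 - ∑_{i ∈ J} α_i)` in the integrand, where the delta function is used to integrate out `α_j`
(`j ∈ J`). -/
noncomputable def reducedIntegral [Fintype E] [DecidableEq E] [Fintype X]
    (G : FeynmanGraph V E X) (D : ℂ) (β : E → ℂ) (s : X → X → ℝ) (J : Finset E) (j : E) : ℂ :=
  ∫ α in {α : {e : E // e ≠ j} → ℝ | ∀ e, 0 < deltaPoint J j α e},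
    G.schwingerIntegrand D β s (deltaPoint J j α)

/-- The number of loops of a connected graph. -/
def loopNumber [Fintype V] [Fintype E] (_G : FeynmanGraph V E X) : ℤ :=
  (Fintype.card E : ℤ) - (Fintype.card V : ℤ) + 1

/-- Scale invariance of the Schwinger integral of a massless connected vacuum graph: the form
`U^{-D/2} ∏ α_e^{β_e - 1} dα_e` has degree `0`; here `U` has degree `loopNumber`. -/
def IsScaleInvariant [Fintype V] [Fintype E] (G : FeynmanGraph V E X) (D : ℂ) (β : E → ℂ) : Prop :=
  ∑ e, β e = (G.loopNumber : ℂ) * (D / 2)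

/-- The scalar products of the external momenta of a two-point graph through which the momentum `p`
flows, `p2 = p ^ 2`: both external edges carry the momentum `p`. -/
def twoPointInvariants (p2 : ℝ) : Fin 2 → Fin 2 → ℝ := fun _ _ => p2

/-- The evaluation `I_G(p^2)` of a two-point graph. -/
noncomputable def twoPointIntegral [Fintype E] (G : FeynmanGraph V E (Fin 2)) (D : ℂ)
    (β : E → ℂ) (p2 : ℝ) : ℂ :=
  G.feynmanIntegral D β (twoPointInvariants p2)

/-- The vacuum graph obtained by joining the two external edges of a two-point graph into a new
internal edge `none`. -/
def close (G : FeynmanGraph V E (Fin 2)) : FeynmanGraph V (Option E) Empty where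
  ends o := o.elim s(G.leg 0, G.leg 1) G.ends
  leg := Empty.elim

/-- The exponents of the closed graph: `β₀` on the new edge, `β` on the old ones. -/
def closeExponents (β₀ : ℂ) (β : E → ℂ) : Option E → ℂ := fun o => o.elim β₀ β

/-- A vacuum graph has no external momenta. -/
def noInvariants : Empty → Empty → ℝ := fun x _ => x.elim

end FeynmanGraph

/-!
Write `U` and `V` for the two Symanzik polynomials of the two-point graph at `p² = 1`. A spanning tree
of the closed graph either avoids the new edge, and then it is a spanning tree of the graph, or
contains it, and then the rest is a spanning `2`-forest that separates the two external vertices. Hence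
the first Symanzik polynomial of the closed graph is `α₀ U + V` (`firstSymanzik_close`). Counting the
edges of forests (`IsForest.card_add_card_component`) shows that `U` and `V` are homogeneous, and
that the degree of `U` is the number of loops, that of `V` one more.

Scaling of the Schwinger parameters gives `I_G(1) = t ^ w I_G(t)` with
`w = ∑ β_e - (number of loops) D / 2`, so for `N ≠ 0` the exponent `β₀ - D / 2` must be `-w`; this is
scale invariance of the closed graph (`isScaleInvariant_close`).

The relation between `N` and the reduced integral comes from integrating `I_G(s) = s ^ (β₀ - D / 2) N`
against `s ^ (D / 2 - 1) exp (-s) ds`. On the one hand the result is `Γ(β₀) N`. On the other hand, by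
Fubini, the `s`-integral of `s ^ (D / 2 - 1) exp (-s) U ^ (-D / 2) exp (-s V / U)` is
`Γ(D / 2) (U + V) ^ (-D / 2)`, and `U + V` is the first Symanzik polynomial of the closed graph at
`α₀ = 1`; the result is `Γ(D / 2) Γ(β₀)` times the reduced integral for `J = {0}`
(`eq_gamma_mul_integral_close_one`). Absolute convergence of the double integral follows from the
same scaling argument, applied to absolute values (`integrable_gamma_schwingerIntegrand`), and yields
convergence of the reduced integral.

The other choices of `J` and `j` are reduced to this one by the theorem of Cheng and Wu, which holds for
every density `g` on the positive orthant that is homogeneous of degree `-n`, `n` being the number of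
variables. For nonnegative `g`, the reduced integral for `J, j` is the integral of
`g(α) w(∑_{i ∈ J} α_i)` over the orthant, where `w(s) = s exp (-s)`
(`lintegral_mul_radialWeight_sum`), and the latter does not change if `∑_{i ∈ J} α_i` is replaced by
another positive function of degree one (`lintegral_mul_radialWeight_congr`). The complex case
follows by decomposition into real and imaginary, positive and negative parts.
-/

namespace FeynmanGraph

/-! ### Joined vertices, forests and their components -/

variable {V E X : Type*}

lemma Joined.refl (G : FeynmanGraph V E X) (T : Set E) (u : V) : G.Joined T u u :=
  SimpleGraph.Reachable.refl u

lemma Joined.symm {G : FeynmanGraph V E X} {T : Set E} {u v : V} (h : G.Joined T u v) :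
    G.Joined T v u :=
  SimpleGraph.Reachable.symm h

lemma Joined.trans {G : FeynmanGraph V E X} {T : Set E} {u v w : V} (h : G.Joined T u v)
    (h' : G.Joined T v w) : G.Joined T u w :=
  SimpleGraph.Reachable.trans h h'

lemma skeleton_mono (G : FeynmanGraph V E X) {S T : Set E} (h : S ⊆ T) :
    G.skeleton S ≤ G.skeleton T := by
  intro u v huv
  simp only [skeleton, SimpleGraph.fromRel_adj] at huv ⊢
  refine ⟨huv.1, huv.2.imp ?_ ?_⟩ <;> exact fun ⟨e, he, h'⟩ => ⟨e, h he, h'⟩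

lemma Joined.mono {G : FeynmanGraph V E X} {S T : Set E} (h : S ⊆ T) {u v : V}
    (huv : G.Joined S u v) : G.Joined T u v :=
  SimpleGraph.Reachable.mono (G.skeleton_mono h) huv

lemma joined_of_mem (G : FeynmanGraph V E X) {T : Set E} {e : E} (he : e ∈ T) {u v : V}
    (h : G.ends e = s(u, v)) : G.Joined T u v := by
  by_cases huv : u = v
  · subst huv; exact Joined.refl _ _ _
  · refine SimpleGraph.Adj.reachable ?_
    simp only [skeleton, SimpleGraph.fromRel_adj]
    exact ⟨huv, Or.inl ⟨e, he, h⟩⟩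

/-- An induction principle: a reflexive relation that is preserved by appending an edge of `T`
holds between joined vertices. -/
lemma Joined.induction {G : FeynmanGraph V E X} {T : Set E} {x : V} {P : V → Prop} (h0 : P x)
    (hstep : ∀ e ∈ T, ∀ u v, G.ends e = s(u, v) → P u → P v) {y : V} (h : G.Joined T x y) :
    P y := by
  rw [Joined, SimpleGraph.reachable_iff_reflTransGen] at h
  induction h with
  | refl => exact h0
  | tail _ hadj ih =>
    simp only [skeleton, SimpleGraph.fromRel_adj] at hadj
    rcases hadj with ⟨-, ⟨e, he, h⟩ | ⟨e, he, h⟩⟩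
    · exact hstep e he _ _ h ih
    · exact hstep e he _ _ (h.trans Sym2.eq_swap) ih

/-- A path that uses the edge `e` can be cut at its first and last passage through `e`. -/
lemma joined_insert_iff (G : FeynmanGraph V E X) {T : Set E} {e : E} {u v : V}
    (he : G.ends e = s(u, v)) {x y : V} :
    G.Joined (insert e T) x y ↔ G.Joined T x y ∨ (G.Joined T x u ∧ G.Joined T v y) ∨
      (G.Joined T x v ∧ G.Joined T u y) := by
  constructor
  · refine Joined.induction (P := fun y => G.Joined T x y ∨ (G.Joined T x u ∧ G.Joined T v y) ∨
      (G.Joined T x v ∧ G.Joined T u y)) (Or.inl (Joined.refl _ _ _)) ?_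
    rintro f (rfl | hf) w z hwz hw
    · rw [he, Sym2.eq_iff] at hwz
      rcases hwz with ⟨rfl, rfl⟩ | ⟨rfl, rfl⟩
      · rcases hw with h | h | h
        · exact Or.inr (Or.inl ⟨h, Joined.refl _ _ _⟩)
        · exact Or.inr (Or.inl ⟨h.1, Joined.refl _ _ _⟩)
        · exact Or.inl h.1
      · rcases hw with h | h | h
        · exact Or.inr (Or.inr ⟨h, Joined.refl _ _ _⟩)
        · exact Or.inl h.1
        · exact Or.inr (Or.inr ⟨h.1, Joined.refl _ _ _⟩)
    · have := G.joined_of_mem hf hwz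
      rcases hw with h | h | h
      · exact Or.inl (h.trans this)
      · exact Or.inr (Or.inl ⟨h.1, h.2.trans this⟩)
      · exact Or.inr (Or.inr ⟨h.1, h.2.trans this⟩)
  · have hm : T ⊆ insert e T := Set.subset_insert _ _
    have huv : G.Joined (insert e T) u v := G.joined_of_mem (Set.mem_insert _ _) he
    rintro (h | h | h)
    · exact h.mono hm
    · exact (h.1.mono hm).trans (huv.trans (h.2.mono hm))
    · exact (h.1.mono hm).trans (huv.symm.trans (h.2.mono hm))

lemma isForest_insert_iff (G : FeynmanGraph V E X) {T : Set E} {e : E} (heT : e ∉ T) {u v : V}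
    (he : G.ends e = s(u, v)) :
    G.IsForest (insert e T) ↔ G.IsForest T ∧ ¬ G.Joined T u v := by
  constructor
  · intro h
    refine ⟨fun f hf x y hxy hj => ?_, fun hj => ?_⟩
    · exact h f (Set.mem_insert_of_mem _ hf) x y hxy
        (hj.mono (Set.sdiff_subset_sdiff_left (Set.subset_insert _ _)))
    · refine h e (Set.mem_insert _ _) u v he ?_
      rwa [Set.insert_sdiff_self_of_notMem heT]
  · rintro ⟨hF, hn⟩ f hf x y hxy hj
    rcases hf with rfl | hf
    · rw [Set.insert_sdiff_self_of_notMem heT] at hj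
      rw [he, Sym2.eq_iff] at hxy
      rcases hxy with ⟨rfl, rfl⟩ | ⟨rfl, rfl⟩
      · exact hn hj
      · exact hn hj.symm
    · have hef : e ≠ f := fun h => heT (h ▸ hf)
      rw [← Set.insert_sdiff_singleton_comm hef, G.joined_insert_iff he] at hj
      have hm : T \ {f} ⊆ T := Set.sdiff_subset
      have hfT := G.joined_of_mem hf hxy
      rcases hj with h | h | h
      · exact hF f hf x y hxy h
      · exact hn (((h.1.mono hm).symm.trans hfT).trans (h.2.mono hm).symm)
      · exact hn ((h.2.mono hm).trans (hfT.symm.trans (h.1.mono hm)))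

/-- An edge between two components merges them: the remaining components are in bijection with
the components other than that of `v`. -/
lemma card_component_insert [Finite V] (G : FeynmanGraph V E X) {T : Set E} {e : E} {u v : V}
    (he : G.ends e = s(u, v)) (huv : ¬ G.Joined T u v) :
    Nat.card (G.skeleton (insert e T)).ConnectedComponent + 1 =
      Nat.card (G.skeleton T).ConnectedComponent := by
  classical
  let c := (G.skeleton T).connectedComponentMk v
  let φ : {d : (G.skeleton T).ConnectedComponent // d ≠ c} →
      (G.skeleton (insert e T)).ConnectedComponent := fun d =>
    d.1.map (SimpleGraph.Hom.ofLE (G.skeleton_mono (Set.subset_insert e T)))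
  have hφ : Function.Bijective φ := by
    constructor
    · rintro ⟨d, hd⟩ ⟨d', hd'⟩ h
      induction d using SimpleGraph.ConnectedComponent.ind with | _ x =>
      induction d' using SimpleGraph.ConnectedComponent.ind with | _ y =>
      have hx : ¬ G.Joined T x v := fun h => hd (SimpleGraph.ConnectedComponent.sound h)
      have hy : ¬ G.Joined T y v := fun h => hd' (SimpleGraph.ConnectedComponent.sound h)
      have h' : G.Joined (insert e T) x y := SimpleGraph.ConnectedComponent.exact h
      rw [G.joined_insert_iff he] at h'
      rcases h' with h' | h' | h'
      · exact Subtype.ext (SimpleGraph.ConnectedComponent.sound h')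
      · exact absurd h'.2.symm hy
      · exact absurd h'.1 hx
    · intro d
      induction d using SimpleGraph.ConnectedComponent.ind with | _ x =>
      by_cases hx : G.Joined T x v
      · refine ⟨⟨(G.skeleton T).connectedComponentMk u,
          fun h => huv (SimpleGraph.ConnectedComponent.exact h)⟩, ?_⟩
        refine SimpleGraph.ConnectedComponent.sound (?_ : G.Joined (insert e T) u x)
        rw [G.joined_insert_iff he]
        exact Or.inr (Or.inl ⟨Joined.refl _ _ _, hx.symm⟩)
      · exact ⟨⟨(G.skeleton T).connectedComponentMk x,
          fun h => hx (SimpleGraph.ConnectedComponent.exact h)⟩, rfl⟩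
  have hfin : Finite (G.skeleton T).ConnectedComponent := inferInstance
  rw [← Nat.card_congr (Equiv.ofBijective φ hφ), ← Finite.card_option]
  exact Nat.card_congr (Equiv.optionSubtypeNe c)

/-- Euler's formula for forests. -/
lemma IsForest.card_add_card_component [Finite V] {G : FeynmanGraph V E X} {T : Finset E}
    (hT : G.IsForest (T : Set E)) :
    T.card + Nat.card (G.skeleton (T : Set E)).ConnectedComponent = Nat.card V := by
  classical
  induction T using Finset.induction_on with
  | empty =>
    have h0 : G.skeleton ((∅ : Finset E) : Set E) = ⊥ := by
      ext u v; simp [skeleton]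
    rw [h0, Finset.card_empty, zero_add]
    refine (Nat.card_congr (Equiv.ofBijective
      (fun v => (⊥ : SimpleGraph V).connectedComponentMk v) ⟨fun u v h => ?_, ?_⟩)).symm
    · simpa using SimpleGraph.ConnectedComponent.exact h
    · exact fun d => d.exists_rep
  | insert e T heT ih =>
    obtain ⟨u, v, he⟩ : ∃ u v, G.ends e = s(u, v) := by
      induction h : G.ends e using Sym2.ind with | _ u v => exact ⟨u, v, rfl⟩
    rw [Finset.coe_insert] at hT ⊢
    rw [G.isForest_insert_iff (by simpa using heT) he] at hT
    have h1 := ih hT.1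
    have h2 := G.card_component_insert he hT.2
    rw [Finset.card_insert_of_notMem heT]
    omega

/-! ### Spanning trees and the first Symanzik polynomial -/

lemma mem_spanningForests [Fintype E] {G : FeynmanGraph V E X} {n : ℕ} {T : Finset E} :
    T ∈ G.spanningForests n ↔ G.IsSpanningForest n (T : Set E) := by
  simp [spanningForests]

/-- A minimal set of edges that connects all vertices is a spanning tree. -/
lemma IsConnected.spanningForests_nonempty [Fintype E] {G : FeynmanGraph V E X}
    (hG : G.IsConnected) : (G.spanningForests 1).Nonempty := by
  classical
  have hne : (Finset.univ.filter fun T : Finset E => (G.skeleton (T : Set E)).Connected).Nonempty :=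
    ⟨Finset.univ, by simpa [IsConnected] using hG⟩
  obtain ⟨T, hT, hmin⟩ := Finset.exists_min_image _ Finset.card hne
  simp only [Finset.mem_filter, Finset.mem_univ, true_and] at hT hmin
  refine ⟨T, mem_spanningForests.2 ⟨fun e he u v huv hj => ?_, ?_⟩⟩
  · have hc : (G.skeleton ((T.erase e : Finset E) : Set E)).Connected := by
      rw [SimpleGraph.connected_iff]
      refine ⟨fun x y => ?_, hT.nonempty⟩
      rw [Finset.coe_erase]
      have hxy : G.Joined (insert e ((T : Set E) \ {e})) x y := by
        rw [Set.insert_sdiff_singleton, Set.insert_eq_of_mem he]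
        exact hT.preconnected x y
      rw [G.joined_insert_iff huv] at hxy
      rcases hxy with h | h | h
      · exact h
      · exact h.1.trans (hj.trans h.2)
      · exact h.1.trans (hj.symm.trans h.2)
    exact absurd (hmin _ hc) (not_le.2 (Finset.card_erase_lt_of_mem he))
  · rw [Nat.card_eq_one_iff_unique]
    have := hT.nonempty
    have := hT.preconnected.subsingleton_connectedComponent
    exact ⟨this, inferInstance⟩

lemma IsConnected.firstSymanzik_pos [Fintype E] {G : FeynmanGraph V E X} (hG : G.IsConnected)
    {α : E → ℝ} (hα : ∀ e, 0 < α e) : 0 < G.firstSymanzik α := by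
  classical
  exact Finset.sum_pos (fun T _ => Finset.prod_pos fun e _ => hα e) hG.spanningForests_nonempty

/-- A spanning tree has `|V| - 1` edges. -/
lemma card_of_mem_spanningForests_one [Fintype V] [Fintype E] {G : FeynmanGraph V E X}
    {T : Finset E} (hT : T ∈ G.spanningForests 1) : T.card + 1 = Fintype.card V := by
  rw [mem_spanningForests] at hT
  have := hT.1.card_add_card_component
  rwa [hT.2, Nat.card_eq_fintype_card] at this

lemma IsConnected.card_le [Fintype V] [Fintype E] {G : FeynmanGraph V E X}
    (hG : G.IsConnected) : Fintype.card V ≤ Fintype.card E + 1 := by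
  obtain ⟨T, hT⟩ := hG.spanningForests_nonempty
  have h1 := card_of_mem_spanningForests_one hT
  have h2 := T.card_le_univ
  omega

/-- The first Symanzik polynomial is homogeneous; its degree is the number of loops. -/
lemma firstSymanzik_smul [Fintype V] [Fintype E] (G : FeynmanGraph V E X) (t : ℝ) (α : E → ℝ) :
    G.firstSymanzik (t • α) =
      t ^ (Fintype.card E + 1 - Fintype.card V) * G.firstSymanzik α := by
  classical
  unfold firstSymanzik
  rw [Finset.mul_sum]
  refine Finset.sum_congr rfl fun T hT => ?_
  have h1 := card_of_mem_spanningForests_one hT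
  simp only [Pi.smul_apply, smul_eq_mul, Finset.prod_mul_distrib, Finset.prod_const]
  rw [← Finset.compl_eq_univ_sdiff, Finset.card_compl]
  congr 2
  omega

lemma continuous_firstSymanzik [Fintype E] (G : FeynmanGraph V E X) :
    Continuous G.firstSymanzik := by
  classical
  unfold firstSymanzik
  fun_prop

/-! ### Closing a two-point graph -/

lemma close_skeleton_image_some (G : FeynmanGraph V E (Fin 2)) (T : Set E) :
    G.close.skeleton (some '' T) = G.skeleton T := by
  ext u v
  simp [skeleton, close]

lemma close_isForest_image_some (G : FeynmanGraph V E (Fin 2)) (T : Set E) :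
    G.close.IsForest (some '' T) ↔ G.IsForest T := by
  simp only [IsForest, Set.forall_mem_image]
  refine forall₂_congr fun e _ => ?_
  rw [← Set.image_singleton, ← Set.image_sdiff (Option.some_injective E)]
  simp only [Joined, close_skeleton_image_some]
  rfl

lemma IsConnected.close {G : FeynmanGraph V E (Fin 2)} (hG : G.IsConnected) :
    G.close.IsConnected := by
  unfold IsConnected at hG ⊢
  rw [← close_skeleton_image_some] at hG
  exact hG.mono (G.close.skeleton_mono (Set.subset_univ _))

/-- The spanning trees of the closed graph without the new edge are those of the graph. -/
lemma close_isSpanningForest_map_some (G : FeynmanGraph V E (Fin 2)) (n : ℕ) (T : Set E) :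
    G.close.IsSpanningForest n (some '' T) ↔ G.IsSpanningForest n T := by
  rw [IsSpanningForest, IsSpanningForest, close_isForest_image_some, close_skeleton_image_some]

/-- The spanning trees of the closed graph through the new edge are the spanning `2`-forests of the
graph that separate the external vertices. -/
lemma close_isSpanningForest_insert_none [Finite V] (G : FeynmanGraph V E (Fin 2)) (T : Set E) :
    G.close.IsSpanningForest 1 (insert none (some '' T)) ↔
      G.IsSpanningForest 2 T ∧ ¬ G.Joined T (G.leg 0) (G.leg 1) := by
  have he : G.close.ends none = s(G.leg 0, G.leg 1) := rfl
  rw [IsSpanningForest, IsSpanningForest, isForest_insert_iff _ (by simp) he,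
    close_isForest_image_some]
  have hJ : G.close.Joined (some '' T) (G.leg 0) (G.leg 1) ↔ G.Joined T (G.leg 0) (G.leg 1) := by
    rw [Joined, close_skeleton_image_some, Joined]
  rw [hJ, and_assoc, and_assoc]
  refine and_congr_right fun _ => ?_
  rw [and_comm]
  refine and_congr_left fun h => ?_
  have := G.close.card_component_insert he (hJ.not.2 h)
  rw [close_skeleton_image_some] at this
  omega

open Classical in
lemma secondSymanzik_twoPoint [Fintype E] (G : FeynmanGraph V E (Fin 2)) (p2 : ℝ) (α : E → ℝ) :
    G.secondSymanzik (twoPointInvariants p2) α =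
      p2 * ∑ T ∈ (G.spanningForests 2).filter
          fun T : Finset E => ¬ G.Joined (T : Set E) (G.leg 0) (G.leg 1),
        ∏ e ∈ Finset.univ \ T, α e := by
  rw [secondSymanzik, Finset.sum_filter, Finset.mul_sum]
  refine Finset.sum_congr rfl fun T _ => ?_
  have h0 := Joined.refl G (T : Set E)
  have h1 : G.Joined (T : Set E) (G.leg 1) (G.leg 0) ↔ G.Joined (T : Set E) (G.leg 0) (G.leg 1) :=
    ⟨Joined.symm, Joined.symm⟩
  simp only [Fin.sum_univ_two, h0, h1, twoPointInvariants]
  split_ifs <;> simp_all; ring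

/-- Deletion and contraction of the new edge: `U` of the closed graph is `α₀ U + V` at `p² = 1`. -/
lemma firstSymanzik_close [Finite V] [Fintype E] (G : FeynmanGraph V E (Fin 2))
    (α : Option E → ℝ) :
    G.close.firstSymanzik α = α none * G.firstSymanzik (fun e => α (some e)) +
      G.secondSymanzik (twoPointInvariants 1) (fun e => α (some e)) := by
  classical
  rw [secondSymanzik_twoPoint, one_mul, firstSymanzik,
    ← Finset.sum_filter_add_sum_filter_not _ (fun T => none ∉ T)]
  congr 1
  · rw [firstSymanzik, Finset.mul_sum]
    refine Finset.sum_nbij' Finset.eraseNone (fun T => T.map Function.Embedding.some) ?_ ?_ ?_ ?_ ?_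
    · intro T hT
      rw [Finset.mem_filter, mem_spanningForests] at hT
      rw [mem_spanningForests, ← close_isSpanningForest_map_some]
      convert hT.1
      ext (_ | x) <;> simp [hT.2]
    · intro T hT
      rw [mem_spanningForests] at hT
      rw [Finset.mem_filter, mem_spanningForests]
      simpa [close_isSpanningForest_map_some] using hT
    · intro T hT
      rw [Finset.mem_filter] at hT
      ext (_ | x) <;> simp [hT.2]
    · intro T _
      ext x; simp
    · intro T hT
      rw [Finset.mem_filter] at hT
      refine (Finset.prod_congr (s₂ := Finset.cons none
        ((Finset.univ \ Finset.eraseNone T).map Function.Embedding.some) (by simp))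
        (by ext (_ | x) <;> simp [hT.2]) fun _ _ => rfl).trans ?_
      rw [Finset.prod_cons, Finset.prod_map]
      rfl
  · refine Finset.sum_nbij' Finset.eraseNone Finset.insertNone ?_ ?_ ?_ ?_ ?_
    · intro T hT
      rw [Finset.mem_filter, mem_spanningForests, not_not] at hT
      rw [Finset.mem_filter, mem_spanningForests, ← close_isSpanningForest_insert_none]
      convert hT.1
      ext (_ | x) <;> simp [hT.2]
    · intro T hT
      rw [Finset.mem_filter, mem_spanningForests, ← close_isSpanningForest_insert_none] at hT
      rw [Finset.mem_filter, mem_spanningForests]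
      refine ⟨?_, by simp⟩
      convert hT
      ext (_ | x) <;> simp
    · intro T hT
      rw [Finset.mem_filter] at hT
      ext (_ | x) <;> simp [not_not.1 hT.2]
    · intro T _
      ext x; simp
    · intro T hT
      rw [Finset.mem_filter] at hT
      refine (Finset.prod_congr
        (s₂ := (Finset.univ \ Finset.eraseNone T).map Function.Embedding.some)
        (by ext (_ | x) <;> simp [not_not.1 hT.2]) fun _ _ => rfl).trans ?_
      rw [Finset.prod_map]
      rfl

lemma secondSymanzik_twoPoint_eq_mul [Fintype E] (G : FeynmanGraph V E (Fin 2)) (p2 : ℝ)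
    (α : E → ℝ) :
    G.secondSymanzik (twoPointInvariants p2) α =
      p2 * G.secondSymanzik (twoPointInvariants 1) α := by
  rw [secondSymanzik_twoPoint, secondSymanzik_twoPoint, one_mul]

lemma secondSymanzik_twoPoint_nonneg [Fintype E] (G : FeynmanGraph V E (Fin 2))
    {α : E → ℝ} (hα : ∀ e, 0 < α e) : 0 ≤ G.secondSymanzik (twoPointInvariants 1) α := by
  rw [secondSymanzik_twoPoint, one_mul]
  exact Finset.sum_nonneg fun T _ => Finset.prod_nonneg fun e _ => (hα e).le

/-- The degree of the second Symanzik polynomial exceeds that of the first by one. -/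
lemma IsConnected.secondSymanzik_smul [Fintype V] [Fintype E] {G : FeynmanGraph V E (Fin 2)}
    (hG : G.IsConnected) (t : ℝ) (α : E → ℝ) :
    G.secondSymanzik (twoPointInvariants 1) (t • α) =
      t ^ (Fintype.card E + 1 - Fintype.card V + 1) *
        G.secondSymanzik (twoPointInvariants 1) α := by
  -- `V` at `p² = 1` is the value of `U` of the closed graph at `α₀ = 0`.
  have key := G.close.firstSymanzik_smul t (fun o => o.elim 0 α)
  rw [firstSymanzik_close, firstSymanzik_close] at key
  have := hG.card_le
  rw [Fintype.card_option, Nat.sub_add_comm this] at key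
  simpa [Pi.smul_def] using key

lemma continuous_secondSymanzik [Fintype E] [Fintype X] (G : FeynmanGraph V E X) (s : X → X → ℝ) :
    Continuous (G.secondSymanzik s) := by
  classical
  unfold secondSymanzik
  fun_prop

/-! ### Projective invariance: the theorem of Cheng and Wu -/

section ChengWu

variable {ι : Type*} [Fintype ι]

lemma lintegral_pi_smul (g : (ι → ℝ) → ENNReal) {t : ℝ} (ht : 0 < t) :
    ∫⁻ α, g α = ENNReal.ofReal (t ^ Fintype.card ι) * ∫⁻ α, g (t • α) := by
  have h := lintegral_map_equiv (μ := (volume : Measure (ι → ℝ))) g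
    (Homeomorph.smul (Units.mk0 t ht.ne')).toMeasurableEquiv
  have h' : Measure.map (Homeomorph.smul (Units.mk0 t ht.ne')).toMeasurableEquiv
      (volume : Measure (ι → ℝ)) = _ := Measure.map_addHaar_smul volume ht.ne'
  rw [h', lintegral_smul_measure, Module.finrank_fintype_fun_eq_card,
    abs_of_pos (by positivity)] at h
  have h2 : ∫⁻ α, g (t • α) = _ := h.symm
  rw [h2, Units.val_mk0, smul_eq_mul, ← mul_assoc, ← ENNReal.ofReal_mul (by positivity),
    mul_inv_cancel₀ (by positivity), ENNReal.ofReal_one, one_mul]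

lemma lintegral_exp_neg_Ioi : ∫⁻ t in Set.Ioi (0 : ℝ), ENNReal.ofReal (Real.exp (-t)) = 1 := by
  rw [← ofReal_integral_eq_lintegral_ofReal (integrableOn_exp_neg_Ioi 0)
    (Filter.Eventually.of_forall fun t => (Real.exp_pos _).le), integral_exp_neg_Ioi_zero,
    ENNReal.ofReal_one]

lemma lintegral_mul_exp_neg_mul_Ioi {a : ℝ} (ha : 0 < a) :
    ∫⁻ t in Set.Ioi (0 : ℝ), ENNReal.ofReal (a * Real.exp (-(t * a))) = 1 := by
  have h1 : IntegrableOn (fun t : ℝ => Real.exp (-a * t)) (Set.Ioi 0) :=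
    integrableOn_exp_mul_Ioi (neg_lt_zero.2 ha) 0
  have h2 : ∀ t : ℝ, a * Real.exp (-(t * a)) = a * Real.exp (-a * t) := fun t => by ring_nf
  simp_rw [h2]
  rw [← ofReal_integral_eq_lintegral_ofReal (h1.const_mul a)
    (Filter.Eventually.of_forall fun t => by positivity), integral_const_mul,
    integral_exp_mul_Ioi (neg_lt_zero.2 ha)]
  have : a * (-Real.exp (-a * 0) / -a) = 1 := by
    rw [mul_zero, Real.exp_zero]; field_simp
  rw [this, ENNReal.ofReal_one]

lemma lintegral_Ioi_inv (g : ℝ → ENNReal) :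
    ∫⁻ t in Set.Ioi (0 : ℝ), g t =
      ∫⁻ t in Set.Ioi (0 : ℝ), ENNReal.ofReal (t ^ 2)⁻¹ * g t⁻¹ := by
  have him : (fun t : ℝ => t⁻¹) '' Set.Ioi 0 = Set.Ioi 0 := by
    ext t
    simp only [Set.mem_image, Set.mem_Ioi]
    exact ⟨fun ⟨x, hx, h⟩ => h ▸ inv_pos.2 hx, fun h => ⟨t⁻¹, inv_pos.2 h, inv_inv t⟩⟩
  have h := lintegral_image_eq_lintegral_abs_deriv_mul (measurableSet_Ioi (a := (0 : ℝ)))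
    (fun t ht => (hasDerivAt_inv (ne_of_gt ht)).hasDerivWithinAt)
    (fun x _ y _ h => inv_injective h) g
  rw [him] at h
  rw [h]
  refine setLIntegral_congr_fun measurableSet_Ioi fun t _ => ?_
  simp only [abs_neg, abs_inv, abs_pow, sq_abs]

/-- The weight `s exp (-s)`, for which `∫ w(s) ds / s = 1`; it vanishes for `s ≤ 0`. -/
noncomputable def radialWeight (s : ℝ) : ENNReal := ENNReal.ofReal (s * Real.exp (-s))

lemma measurable_radialWeight : Measurable radialWeight := by
  unfold radialWeight; fun_prop

/-- The integral of a density of degree `-n` against a radial weight does not depend on the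
function, homogeneous of degree one, by which the distance from the origin is measured. -/
lemma lintegral_mul_radialWeight_congr {g : (ι → ℝ) → ENNReal} (hg : Measurable g)
    (hhom : ∀ t : ℝ, 0 < t → ∀ α, g α = ENNReal.ofReal (t ^ Fintype.card ι) * g (t • α))
    {h₁ h₂ : (ι → ℝ) → ℝ} (hm₁ : Measurable h₁) (hm₂ : Measurable h₂)
    (hs₁ : ∀ (t : ℝ) α, h₁ (t • α) = t * h₁ α) (hs₂ : ∀ (t : ℝ) α, h₂ (t • α) = t * h₂ α)
    (hp₁ : ∀ α, g α ≠ 0 → 0 < h₁ α) (hp₂ : ∀ α, g α ≠ 0 → 0 < h₂ α) :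
    ∫⁻ α, g α * radialWeight (h₁ α) = ∫⁻ α, g α * radialWeight (h₂ α) := by
  -- Both sides equal the integral over `α` and `t > 0` of `g(α) w(h₁ α) w(t h₂ α) dα dt / t`,
  -- by integration over `t` first, before and after the substitution `α → α / t`.
  have hw := measurable_radialWeight
  have e1 : ∀ α, g α * radialWeight (h₁ α) = ∫⁻ t in Set.Ioi (0 : ℝ),
      g α * radialWeight (h₁ α) * ENNReal.ofReal (h₂ α * Real.exp (-(t * h₂ α))) := by
    intro α
    by_cases h0 : g α = 0
    · simp [h0]
    · rw [lintegral_const_mul _ (by fun_prop), lintegral_mul_exp_neg_mul_Ioi (hp₂ α h0), mul_one]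
  have e2 : ∀ α, g α * radialWeight (h₂ α) = ∫⁻ t in Set.Ioi (0 : ℝ),
      g α * radialWeight (h₂ α) *
        (ENNReal.ofReal (t ^ 2)⁻¹ * ENNReal.ofReal (h₁ α * Real.exp (-(t⁻¹ * h₁ α)))) := by
    intro α
    by_cases h0 : g α = 0
    · simp [h0]
    · rw [lintegral_const_mul _ (by fun_prop),
        ← lintegral_Ioi_inv fun t => ENNReal.ofReal (h₁ α * Real.exp (-(t * h₁ α))),
        lintegral_mul_exp_neg_mul_Ioi (hp₁ α h0), mul_one]
  refine (lintegral_congr e1).trans (Eq.trans ?_ (lintegral_congr e2).symm)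
  refine (lintegral_lintegral_swap (by fun_prop)).trans
    (Eq.trans ?_ (lintegral_lintegral_swap (by fun_prop)).symm)
  refine setLIntegral_congr_fun measurableSet_Ioi fun t (ht : 0 < t) => ?_
  have hti : 0 < t⁻¹ := inv_pos.2 ht
  rw [lintegral_pi_smul _ hti, ← lintegral_const_mul _ (by fun_prop)]
  refine lintegral_congr fun α => ?_
  by_cases h0 : g α = 0
  · have := hhom _ hti α
    rw [h0, eq_comm, mul_eq_zero] at this
    rcases this with h | h
    · exact absurd h (by simpa using pow_pos hti _)
    · simp [h0, h]
  · have p1 := hp₁ α h0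
    have p2 := hp₂ α h0
    have key : radialWeight (t⁻¹ * h₁ α) *
        ENNReal.ofReal (t⁻¹ * h₂ α * Real.exp (-(t * (t⁻¹ * h₂ α)))) =
        radialWeight (h₂ α) *
          (ENNReal.ofReal (t ^ 2)⁻¹ * ENNReal.ofReal (h₁ α * Real.exp (-(t⁻¹ * h₁ α)))) := by
      unfold radialWeight
      rw [← ENNReal.ofReal_mul (by positivity), ← ENNReal.ofReal_mul (by positivity),
        ← ENNReal.ofReal_mul (by positivity), mul_inv_cancel_left₀ ht.ne']
      congr 1
      ring
    rw [hs₁, hs₂, mul_assoc (g _), key, ← mul_assoc, ← hhom _ hti α, ← mul_assoc]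

lemma measurableSet_orthant : MeasurableSet {α : ι → ℝ | ∀ e, 0 < α e} := by
  have : {α : ι → ℝ | ∀ e, 0 < α e} = ⋂ e, {α | 0 < α e} := by ext; simp
  rw [this]
  exact MeasurableSet.iInter fun e => measurableSet_lt measurable_const (measurable_pi_apply e)

variable [DecidableEq ι]

/-- The point with `j`-th coordinate `t` and the other coordinates `x`. -/
def insertCoord (j : ι) (t : ℝ) (x : {e : ι // e ≠ j} → ℝ) : ι → ℝ :=
  fun e => if h : e = j then t else x ⟨e, h⟩

/-- The contribution of the coordinates other than the `j`-th to `∑_{i ∈ J} α_i`. -/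
def restSum (J : Finset ι) (j : ι) (x : {e : ι // e ≠ j} → ℝ) : ℝ :=
  ∑ i : {e : ι // e ≠ j}, if (i : ι) ∈ J then x i else 0

lemma deltaPoint_eq (J : Finset ι) (j : ι) (x : {e : ι // e ≠ j} → ℝ) :
    deltaPoint J j x = insertCoord j (1 - restSum J j x) x := rfl

lemma smul_deltaPoint (J : Finset ι) (j : ι) (t : ℝ) (x : {e : ι // e ≠ j} → ℝ) :
    t • deltaPoint J j x = insertCoord j (t - restSum J j (t • x)) (t • x) := by
  have h : restSum J j (t • x) = t * restSum J j x := by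
    simp [restSum, Finset.mul_sum, mul_ite]
  ext e
  rw [deltaPoint_eq, h]
  by_cases he : e = j <;> simp [insertCoord, he, mul_sub]

lemma sum_insertCoord {J : Finset ι} {j : ι} (hj : j ∈ J) (t : ℝ) (x : {e : ι // e ≠ j} → ℝ) :
    ∑ i ∈ J, insertCoord j t x i = t + restSum J j x := by
  have h1 : ∑ i ∈ J, insertCoord j t x i = ∑ i, if i ∈ J then insertCoord j t x i else 0 := by
    simp
  rw [h1, ← Fintype.sum_subtype_add_sum_subtype (fun i => i = j), restSum]
  congr 1
  · have hd : ((default : {e : ι // e = j}) : ι) = j := (default : {e : ι // e = j}).2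
    simp [insertCoord, hd, hj]
  · refine Finset.sum_congr rfl fun i _ => ?_
    have hi : (i : ι) ≠ j := i.2
    simp [insertCoord, hi]

lemma measurable_restSum (J : Finset ι) (j : ι) : Measurable (restSum J j) := by
  unfold restSum
  refine Finset.measurable_sum _ fun i _ => ?_
  split_ifs <;> fun_prop

omit [Fintype ι] in
lemma measurable_insertCoord (j : ι) :
    Measurable fun p : ℝ × ({e : ι // e ≠ j} → ℝ) => insertCoord j p.1 p.2 := by
  refine measurable_pi_iff.2 fun e => ?_
  unfold insertCoord
  split_ifs <;> fun_prop

lemma measurable_deltaPoint (J : Finset ι) (j : ι) : Measurable (deltaPoint J j) := by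
  have := measurable_restSum J j
  exact (measurable_insertCoord j).comp
    (f := fun x => (1 - restSum J j x, x)) (by fun_prop)

lemma lintegral_eq_lintegral_insertCoord (j : ι) {F : (ι → ℝ) → ENNReal} (hF : Measurable F) :
    ∫⁻ α, F α = ∫⁻ x : {e : ι // e ≠ j} → ℝ, ∫⁻ t : ℝ, F (insertCoord j t x) := by
  -- `piEquivPiSubtypeProd` and `funUnique` come with different `Fintype` instances on `{e // e = j}`.
  let : Fintype {e : ι // e = j} := Subtype.fintype _
  have m1 : MeasurePreserving
      (MeasurableEquiv.piEquivPiSubtypeProd (fun _ : ι => ℝ) (fun e => e = j)).symm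
      ((volume : Measure ({e : ι // e = j} → ℝ)).prod
        (volume : Measure ({e : ι // ¬ e = j} → ℝ))) volume :=
    (volume_preserving_piEquivPiSubtypeProd (fun _ : ι => ℝ) (fun e => e = j)).symm
  have m2 : MeasurePreserving (MeasurableEquiv.funUnique {e : ι // e = j} ℝ).symm volume volume := by
    convert (volume_preserving_funUnique {e : ι // e = j} ℝ).symm
  have m3 := m1.comp (m2.prod (MeasurePreserving.id
    (volume : Measure ({e : ι // ¬ e = j} → ℝ))))
  have hpt : ∀ p : ℝ × ({e : ι // ¬ e = j} → ℝ),
      ((MeasurableEquiv.piEquivPiSubtypeProd (fun _ : ι => ℝ) (fun e => e = j)).symm ∘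
        Prod.map (MeasurableEquiv.funUnique {e : ι // e = j} ℝ).symm id) p =
      insertCoord j p.1 p.2 := by
    intro p
    ext e
    by_cases h : e = j <;>
      simp [insertCoord, h, MeasurableEquiv.piEquivPiSubtypeProd, Equiv.piEquivPiSubtypeProd]
  rw [← m3.lintegral_comp hF]
  simp_rw [hpt]
  have hm := hF.comp (measurable_insertCoord j)
  exact lintegral_prod_symm _ hm.aemeasurable

/-- In the coordinates `t = ∑_{i ∈ J} α_i` and `α_i / t`, a density of degree `-n` is the product of
`dt / t` and of its restriction to the hyperplane `∑_{i ∈ J} α_i = 1`. -/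
lemma lintegral_mul_radialWeight_sum {g : (ι → ℝ) → ENNReal} (hg : Measurable g)
    (hhom : ∀ t : ℝ, 0 < t → ∀ α, g α = ENNReal.ofReal (t ^ Fintype.card ι) * g (t • α))
    {J : Finset ι} {j : ι} (hj : j ∈ J) :
    ∫⁻ α, g α * radialWeight (∑ i ∈ J, α i) = ∫⁻ x, g (deltaPoint J j x) := by
  have hw := measurable_radialWeight
  have hr := measurable_restSum J j
  have hi := measurable_insertCoord j
  rw [lintegral_eq_lintegral_insertCoord j (by fun_prop)]
  simp_rw [sum_insertCoord hj]
  -- For fixed other coordinates, `t = ∑_{i ∈ J} α_i` is a translate of `α_j`.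
  have hshear : ∀ x : {e : ι // e ≠ j} → ℝ,
      ∫⁻ t : ℝ, g (insertCoord j t x) * radialWeight (t + restSum J j x) =
        ∫⁻ t : ℝ, g (insertCoord j (t - restSum J j x) x) * radialWeight t := by
    intro x
    rw [← lintegral_sub_right_eq_self _ (restSum J j x)]
    simp only [sub_add_cancel]
  simp_rw [hshear]
  have hmeas : Measurable fun p : ({e : ι // e ≠ j} → ℝ) × ℝ =>
      g (insertCoord j (p.2 - restSum J j p.1) p.1) * radialWeight p.2 := by
    refine Measurable.mul (hg.comp (hi.comp
      (f := fun p : ({e : ι // e ≠ j} → ℝ) × ℝ => (p.2 - restSum J j p.1, p.1)) ?_)) ?_ <;>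
    fun_prop
  rw [lintegral_lintegral_swap hmeas.aemeasurable]
  have hgd : Measurable fun x => g (deltaPoint J j x) := hg.comp (measurable_deltaPoint J j)
  -- Rescaling the `n - 1` other coordinates by `t > 0` gives `t ^ (n - 1)`, homogeneity gives `t ^ (-n)`.
  have hslice : ∀ t : ℝ, ∫⁻ x : {e : ι // e ≠ j} → ℝ,
      g (insertCoord j (t - restSum J j x) x) * radialWeight t =
        (Set.Ioi (0 : ℝ)).indicator (fun t => ENNReal.ofReal (Real.exp (-t)) *
          ∫⁻ x, g (deltaPoint J j x)) t := by
    intro t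
    by_cases ht : 0 < t
    · rw [Set.indicator_of_mem (Set.mem_Ioi.2 ht), lintegral_pi_smul _ ht]
      simp_rw [← smul_deltaPoint]
      have hgt : Measurable fun x => g (t • deltaPoint J j x) :=
        hg.comp ((measurable_deltaPoint J j).const_smul t)
      rw [lintegral_mul_const _ hgt, mul_comm (ENNReal.ofReal (Real.exp _))]
      have hc : ∫⁻ x, g (deltaPoint J j x) =
          ENNReal.ofReal (t ^ Fintype.card ι) * ∫⁻ x, g (t • deltaPoint J j x) := by
        rw [← lintegral_const_mul _ hgt]
        exact lintegral_congr fun x => hhom t ht _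
      have hn : Fintype.card ι = Fintype.card {e : ι // e ≠ j} + 1 := by
        rw [← Fintype.card_congr (Equiv.optionSubtypeNe j), Fintype.card_option]
      rw [hc, hn, pow_succ, radialWeight, ENNReal.ofReal_mul ht.le,
        ENNReal.ofReal_mul (by positivity)]
      ring
    · rw [Set.indicator_of_notMem (by simpa using ht), radialWeight,
        ENNReal.ofReal_of_nonpos (mul_nonpos_of_nonpos_of_nonneg (not_lt.1 ht) (Real.exp_pos _).le)]
      simp
  simp_rw [hslice]
  rw [lintegral_indicator measurableSet_Ioi, lintegral_mul_const _ (by fun_prop),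
    lintegral_exp_neg_Ioi, one_mul]

/-- The integral of a nonnegative density of degree `-n` over the section of the positive orthant by
`∑_{i ∈ J} α_i = 1` depends neither on `J` nor on the variable that is eliminated. -/
lemma setLIntegral_deltaPoint_congr {g : (ι → ℝ) → ENNReal} (hg : Measurable g)
    (hhom : ∀ t : ℝ, 0 < t → ∀ α, (∀ e, 0 < α e) →
      g α = ENNReal.ofReal (t ^ Fintype.card ι) * g (t • α))
    {J J' : Finset ι} {j j' : ι} (hj : j ∈ J) (hj' : j' ∈ J') :
    ∫⁻ x in {x | ∀ e, 0 < deltaPoint J j x e}, g (deltaPoint J j x) =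
      ∫⁻ x in {x | ∀ e, 0 < deltaPoint J' j' x e}, g (deltaPoint J' j' x) := by
  set O : Set (ι → ℝ) := {α | ∀ e, 0 < α e}
  have hO : MeasurableSet O := measurableSet_orthant
  have hind : ∀ (K : Finset ι) (k : ι),
      ∫⁻ x in {x | ∀ e, 0 < deltaPoint K k x e}, g (deltaPoint K k x) =
        ∫⁻ x, O.indicator g (deltaPoint K k x) := fun K k =>
    (lintegral_indicator (measurable_deltaPoint K k hO) _).symm
  have hhom' : ∀ t : ℝ, 0 < t → ∀ α, O.indicator g α =
      ENNReal.ofReal (t ^ Fintype.card ι) * O.indicator g (t • α) := by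
    intro t ht α
    have hiff : t • α ∈ O ↔ α ∈ O := forall_congr' fun e => by
      simp [ht]
    by_cases hα : α ∈ O
    · rw [Set.indicator_of_mem hα, Set.indicator_of_mem (hiff.2 hα), hhom t ht α hα]
    · rw [Set.indicator_of_notMem hα, Set.indicator_of_notMem (mt hiff.1 hα), mul_zero]
  have hsum : ∀ (K : Finset ι) (t : ℝ) (α : ι → ℝ),
      ∑ i ∈ K, (t • α) i = t * ∑ i ∈ K, α i := fun K t α => by
    simp [Finset.mul_sum]
  have hpos : ∀ {K : Finset ι} {k : ι}, k ∈ K → ∀ α : ι → ℝ, O.indicator g α ≠ 0 →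
      0 < ∑ i ∈ K, α i := fun {K k} hk α h =>
    Finset.sum_pos (fun i _ => (Set.mem_of_indicator_ne_zero h : α ∈ O) i) ⟨k, hk⟩
  have hgO := hg.indicator hO
  rw [hind, hind, ← lintegral_mul_radialWeight_sum hgO hhom' hj,
    ← lintegral_mul_radialWeight_sum hgO hhom' hj']
  exact lintegral_mul_radialWeight_congr hgO hhom' (by fun_prop) (by fun_prop) (hsum J) (hsum J')
    (hpos hj) (hpos hj')

/-- Absolute convergence of the integral of a density of degree `-n` over the section of the positive
orthant by `∑_{i ∈ J} α_i = 1` does not depend on `J` and `j`. -/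
lemma integrableOn_deltaPoint_congr {f : (ι → ℝ) → ℂ} (hf : Measurable f)
    (hhom : ∀ t : ℝ, 0 < t → ∀ α, (∀ e, 0 < α e) →
      f α = ((t ^ Fintype.card ι : ℝ) : ℂ) * f (t • α))
    {J J' : Finset ι} {j j' : ι} (hj : j ∈ J) (hj' : j' ∈ J')
    (h : IntegrableOn (fun x => f (deltaPoint J j x)) {x | ∀ e, 0 < deltaPoint J j x e}) :
    IntegrableOn (fun x => f (deltaPoint J' j' x)) {x | ∀ e, 0 < deltaPoint J' j' x e} := by
  refine ⟨(hf.comp (measurable_deltaPoint J' j')).aestronglyMeasurable, ?_⟩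
  have h2 := h.2
  rw [hasFiniteIntegral_iff_enorm] at h2 ⊢
  rwa [← setLIntegral_deltaPoint_congr (g := fun α => ‖f α‖ₑ) hf.enorm ?_ hj hj']
  intro t ht α hα
  rw [hhom t ht α hα, enorm_mul]
  congr 1
  rw [← ofReal_norm, Complex.norm_real, Real.norm_of_nonneg (by positivity)]

lemma setIntegral_deltaPoint_real_congr {f : (ι → ℝ) → ℝ} (hf : Measurable f)
    (hhom : ∀ t : ℝ, 0 < t → ∀ α, (∀ e, 0 < α e) → f α = t ^ Fintype.card ι * f (t • α))
    {J J' : Finset ι} {j j' : ι} (hj : j ∈ J) (hj' : j' ∈ J')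
    (h : IntegrableOn (fun x => f (deltaPoint J j x)) {x | ∀ e, 0 < deltaPoint J j x e})
    (h' : IntegrableOn (fun x => f (deltaPoint J' j' x)) {x | ∀ e, 0 < deltaPoint J' j' x e}) :
    ∫ x in {x | ∀ e, 0 < deltaPoint J j x e}, f (deltaPoint J j x) =
      ∫ x in {x | ∀ e, 0 < deltaPoint J' j' x e}, f (deltaPoint J' j' x) := by
  rw [integral_eq_lintegral_pos_part_sub_lintegral_neg_part h,
    integral_eq_lintegral_pos_part_sub_lintegral_neg_part h']
  congr 2
  · refine setLIntegral_deltaPoint_congr (g := fun α => ENNReal.ofReal (f α)) (by fun_prop) ?_ hj hj'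
    intro t ht α hα
    rw [hhom t ht α hα, ENNReal.ofReal_mul (by positivity)]
  · refine setLIntegral_deltaPoint_congr (g := fun α => ENNReal.ofReal (-f α)) (by fun_prop) ?_
      hj hj'
    intro t ht α hα
    rw [hhom t ht α hα, ← mul_neg, ENNReal.ofReal_mul (by positivity)]

/-- Theorem of Cheng and Wu: the projective integral of a density of degree `-n` may be computed on any
of the hyperplanes `∑_{i ∈ J} α_i = 1`, with any of the variables `α_j`, `j ∈ J`, eliminated. -/
lemma setIntegral_deltaPoint_congr {f : (ι → ℝ) → ℂ} (hf : Measurable f)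
    (hhom : ∀ t : ℝ, 0 < t → ∀ α, (∀ e, 0 < α e) →
      f α = ((t ^ Fintype.card ι : ℝ) : ℂ) * f (t • α))
    {J J' : Finset ι} {j j' : ι} (hj : j ∈ J) (hj' : j' ∈ J')
    (h : IntegrableOn (fun x => f (deltaPoint J j x)) {x | ∀ e, 0 < deltaPoint J j x e}) :
    ∫ x in {x | ∀ e, 0 < deltaPoint J j x e}, f (deltaPoint J j x) =
      ∫ x in {x | ∀ e, 0 < deltaPoint J' j' x e}, f (deltaPoint J' j' x) := by
  have h' := integrableOn_deltaPoint_congr hf hhom hj hj' h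
  rw [← integral_re_add_im h, ← integral_re_add_im h']
  refine congrArg₂ (fun a b : ℝ => (a : ℂ) + (b : ℂ) * RCLike.I) ?_ ?_
  · refine setIntegral_deltaPoint_real_congr (f := fun α => (f α).re) (by fun_prop) ?_ hj hj'
      h.re h'.re
    intro t ht α hα
    rw [hhom t ht α hα, Complex.re_ofReal_mul]
  · refine setIntegral_deltaPoint_real_congr (f := fun α => (f α).im) (by fun_prop) ?_ hj hj'
      h.im h'.im
    intro t ht α hα
    rw [hhom t ht α hα, Complex.im_ofReal_mul]

end ChengWu

/-! ### Scaling of the Schwinger integrand -/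

/-- The algebraic factor `(∏_e α_e^{β_e - 1} / Γ(β_e)) U^{-D/2}` of the Schwinger integrand. -/
noncomputable def schwingerDensity [Fintype E] (G : FeynmanGraph V E X) (D : ℂ) (β : E → ℂ)
    (α : E → ℝ) : ℂ :=
  (∏ e, (α e : ℂ) ^ (β e - 1) / Complex.Gamma (β e)) * (G.firstSymanzik α : ℂ) ^ (-(D / 2))

lemma measurable_schwingerDensity [Fintype E] (G : FeynmanGraph V E X) (D : ℂ) (β : E → ℂ) :
    Measurable (G.schwingerDensity D β) := by
  have := G.continuous_firstSymanzik.measurable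
  unfold schwingerDensity
  fun_prop

lemma ofReal_pow_cpow {t : ℝ} (ht : 0 < t) (n : ℕ) (z : ℂ) :
    ((t ^ n : ℝ) : ℂ) ^ z = (t : ℂ) ^ (n * z) := by
  rw [Complex.cpow_def_of_ne_zero (by exact_mod_cast (pow_pos ht n).ne'),
    Complex.cpow_def_of_ne_zero (by exact_mod_cast ht.ne'), ← Complex.ofReal_log (by positivity),
    ← Complex.ofReal_log ht.le, Real.log_pow]
  push_cast
  ring_nf

lemma prod_cpow {ι : Type*} (s : Finset ι) {x : ℂ} (hx : x ≠ 0) (z : ι → ℂ) :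
    ∏ i ∈ s, x ^ z i = x ^ ∑ i ∈ s, z i := by
  classical
  induction s using Finset.induction_on with
  | empty => simp
  | insert i s hi ih => rw [Finset.prod_insert hi, Finset.sum_insert hi, ih, Complex.cpow_add _ _ hx]

lemma schwingerDensity_smul [Fintype V] [Fintype E] {G : FeynmanGraph V E X}
    (hG : G.IsConnected) (D : ℂ) (β : E → ℂ) {t : ℝ} (ht : 0 < t) {α : E → ℝ}
    (hα : ∀ e, 0 < α e) :
    G.schwingerDensity D β (t • α) =
      (t : ℂ) ^ (∑ e, β e - Fintype.card E - G.loopNumber * (D / 2)) *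
        G.schwingerDensity D β α := by
  have htc : (t : ℂ) ≠ 0 := by exact_mod_cast ht.ne'
  have h1 : ∏ e, ((t • α) e : ℂ) ^ (β e - 1) / Complex.Gamma (β e) =
      (t : ℂ) ^ (∑ e, (β e - 1)) * ∏ e, (α e : ℂ) ^ (β e - 1) / Complex.Gamma (β e) := by
    rw [← prod_cpow _ htc, ← Finset.prod_mul_distrib]
    refine Finset.prod_congr rfl fun e _ => ?_
    rw [Pi.smul_apply, smul_eq_mul, Complex.ofReal_mul,
      Complex.mul_cpow_ofReal_nonneg ht.le (hα e).le, mul_div_assoc]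
  have hL : ((Fintype.card E + 1 - Fintype.card V : ℕ) : ℂ) = G.loopNumber := by
    have := hG.card_le
    rw [loopNumber, Nat.cast_sub this]
    push_cast
    ring
  have hU := hG.firstSymanzik_pos hα
  rw [schwingerDensity, h1, firstSymanzik_smul, Complex.ofReal_mul,
    Complex.mul_cpow_ofReal_nonneg (by positivity) hU.le, ofReal_pow_cpow ht, hL,
    mul_mul_mul_comm, ← Complex.cpow_add _ _ htc, schwingerDensity]
  congr 2
  simp only [Finset.sum_sub_distrib, Finset.sum_const, Finset.card_univ, nsmul_eq_mul, mul_one]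
  ring

lemma schwingerIntegrand_eq [Fintype E] (G : FeynmanGraph V E (Fin 2)) (D : ℂ) (β : E → ℂ)
    (p2 : ℝ) (α : E → ℝ) :
    G.schwingerIntegrand D β (twoPointInvariants p2) α = G.schwingerDensity D β α *
      Complex.exp (-((p2 * (G.secondSymanzik (twoPointInvariants 1) α /
        G.firstSymanzik α) : ℝ) : ℂ)) := by
  rw [schwingerIntegrand, schwingerDensity, secondSymanzik_twoPoint_eq_mul]
  push_cast
  rw [mul_div_assoc]

lemma schwingerIntegrand_noInvariants [Fintype E] (G : FeynmanGraph V E Empty) (D : ℂ)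
    (β : E → ℂ) (α : E → ℝ) :
    G.schwingerIntegrand D β noInvariants α = G.schwingerDensity D β α := by
  simp [schwingerIntegrand, schwingerDensity, secondSymanzik]

lemma schwingerIntegrand_smul [Fintype V] [Fintype E] {G : FeynmanGraph V E (Fin 2)}
    (hG : G.IsConnected) (D : ℂ) (β : E → ℂ) (p2 : ℝ) {t : ℝ} (ht : 0 < t) {α : E → ℝ}
    (hα : ∀ e, 0 < α e) :
    G.schwingerIntegrand D β (twoPointInvariants p2) (t • α) =
      (t : ℂ) ^ (∑ e, β e - Fintype.card E - G.loopNumber * (D / 2)) *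
        G.schwingerIntegrand D β (twoPointInvariants (p2 * t)) α := by
  have hU := (hG.firstSymanzik_pos hα).ne'
  have h : G.secondSymanzik (twoPointInvariants 1) (t • α) / G.firstSymanzik (t • α) =
      t * (G.secondSymanzik (twoPointInvariants 1) α / G.firstSymanzik α) := by
    rw [hG.secondSymanzik_smul, firstSymanzik_smul, pow_succ]
    field_simp
  rw [schwingerIntegrand_eq, schwingerIntegrand_eq, schwingerDensity_smul hG D β ht hα, h,
    mul_assoc, mul_assoc p2]

open scoped Pointwise in
lemma setIntegral_orthant_smul [Fintype E] {F : Type*} [NormedAddCommGroup F] [NormedSpace ℝ F]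
    (f : (E → ℝ) → F) {t : ℝ} (ht : 0 < t) :
    ∫ α in {α : E → ℝ | ∀ e, 0 < α e}, f α =
      (t ^ Fintype.card E) • ∫ α in {α : E → ℝ | ∀ e, 0 < α e}, f (t • α) := by
  have hO : t • {α : E → ℝ | ∀ e, 0 < α e} = {α : E → ℝ | ∀ e, 0 < α e} := by
    ext α
    rw [Set.mem_smul_set_iff_inv_smul_mem₀ ht.ne']
    simp [ht]
  rw [Measure.setIntegral_comp_smul_of_pos _ _ _ ht, hO, Module.finrank_fintype_fun_eq_card,
    smul_smul, mul_inv_cancel₀ (by positivity), one_smul]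

/-- By scaling of the Schwinger parameters, `I_G(1) = t^w I_G(t)` with
`w = ∑_e β_e - (loop number) D / 2`. -/
lemma twoPointIntegral_one [Fintype V] [Fintype E] {G : FeynmanGraph V E (Fin 2)}
    (hG : G.IsConnected) (D : ℂ) (β : E → ℂ) {t : ℝ} (ht : 0 < t) :
    G.twoPointIntegral D β 1 =
      (t : ℂ) ^ (∑ e, β e - G.loopNumber * (D / 2)) * G.twoPointIntegral D β t := by
  have htc : (t : ℂ) ≠ 0 := by exact_mod_cast ht.ne'
  unfold twoPointIntegral feynmanIntegral
  rw [setIntegral_orthant_smul _ ht, setIntegral_congr_fun measurableSet_orthant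
    fun α hα => schwingerIntegrand_smul hG D β 1 ht hα, integral_const_mul, one_mul,
    Complex.real_smul, ← mul_assoc, Complex.ofReal_pow, ← Complex.cpow_natCast,
    ← Complex.cpow_add _ _ htc]
  congr 2
  ring

/-- Scaling of the Schwinger parameters, for absolute values. -/
lemma integral_norm_twoPoint [Fintype V] [Fintype E] {G : FeynmanGraph V E (Fin 2)}
    (hG : G.IsConnected) (D : ℂ) (β : E → ℂ) {t : ℝ} (ht : 0 < t) :
    ∫ α in {α : E → ℝ | ∀ e, 0 < α e}, ‖G.schwingerIntegrand D β (twoPointInvariants t) α‖ =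
      t ^ (-(∑ e, β e - G.loopNumber * (D / 2)).re) *
      ∫ α in {α : E → ℝ | ∀ e, 0 < α e}, ‖G.schwingerIntegrand D β (twoPointInvariants 1) α‖ := by
  have h : ∫ α in {α : E → ℝ | ∀ e, 0 < α e},
      ‖G.schwingerIntegrand D β (twoPointInvariants 1) α‖ =
      t ^ (∑ e, β e - G.loopNumber * (D / 2)).re * ∫ α in {α : E → ℝ | ∀ e, 0 < α e},
        ‖G.schwingerIntegrand D β (twoPointInvariants t) α‖ := by
    rw [setIntegral_orthant_smul _ ht, setIntegral_congr_fun measurableSet_orthant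
      fun α hα => congrArg norm (schwingerIntegrand_smul hG D β 1 ht hα)]
    simp only [norm_mul, one_mul]
    rw [integral_const_mul, smul_eq_mul, ← mul_assoc, Complex.norm_cpow_eq_rpow_re_of_pos ht,
      ← Real.rpow_natCast, ← Real.rpow_add ht]
    congr 2
    simp only [Complex.sub_re, Complex.natCast_re]
    ring
  rw [h, ← mul_assoc, ← Real.rpow_add ht, neg_add_cancel, Real.rpow_zero, one_mul]

/-- The derivative of `t ^ z` at `t = 1` is `z`. -/
lemma eq_zero_of_forall_cpow_eq_one {z : ℂ} (h : ∀ t : ℝ, 0 < t → (t : ℂ) ^ z = 1) : z = 0 := by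
  have h1 : HasDerivAt (fun t : ℝ => (t : ℂ) ^ z) (z * (1 : ℂ) ^ (z - 1)) 1 := by
    have := (hasDerivAt_id (1 : ℂ)).cpow_const (c := z) (by simp)
    simpa using this.comp_ofReal
  have h2 : (fun t : ℝ => (t : ℂ) ^ z) =ᶠ[nhds 1] fun _ => 1 :=
    (eventually_gt_nhds one_pos).mono h
  have := (h1.congr_of_eventuallyEq h2.symm).unique (hasDerivAt_const _ _)
  simpa using this

lemma loopNumber_close [Fintype V] [Fintype E] (G : FeynmanGraph V E (Fin 2)) :
    G.close.loopNumber = G.loopNumber + 1 := by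
  simp only [loopNumber, Fintype.card_option]
  push_cast
  ring

lemma isScaleInvariant_close_iff [Fintype V] [Fintype E] (G : FeynmanGraph V E (Fin 2))
    (D : ℂ) (β : E → ℂ) (β₀ : ℂ) :
    G.close.IsScaleInvariant D (closeExponents β₀ β) ↔
      β₀ - D / 2 = -(∑ e, β e - G.loopNumber * (D / 2)) := by
  simp only [IsScaleInvariant, loopNumber_close, closeExponents, Fintype.sum_option, Option.elim]
  push_cast
  constructor <;> intro h <;> linear_combination h

/-- A nonzero power `(p²)^{β₀ - D/2}` must agree with the power that results from scaling. -/
lemma isScaleInvariant_close [Fintype V] [Fintype E] {G : FeynmanGraph V E (Fin 2)}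
    (hG : G.IsConnected) {D : ℂ} {β : E → ℂ} {β₀ N : ℂ}
    (hN : ∀ p2 : ℝ, 0 < p2 → G.twoPointIntegral D β p2 = (p2 : ℂ) ^ (β₀ - D / 2) * N)
    (hN0 : N ≠ 0) : G.close.IsScaleInvariant D (closeExponents β₀ β) := by
  rw [isScaleInvariant_close_iff, eq_neg_iff_add_eq_zero]
  refine eq_zero_of_forall_cpow_eq_one fun t ht => ?_
  have h := twoPointIntegral_one hG D β ht
  rw [hN 1 one_pos, hN t ht, Complex.ofReal_one, Complex.one_cpow, one_mul, ← mul_assoc] at h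
  rw [add_comm, Complex.cpow_add _ _ (by exact_mod_cast ht.ne')]
  exact mul_right_cancel₀ hN0 (h.symm.trans (one_mul N).symm)

/-! ### The reduced integral with `α₀ = 1` -/

lemma schwingerDensity_close_one [Finite V] [Fintype E] (G : FeynmanGraph V E (Fin 2)) (D : ℂ)
    (β : E → ℂ) (β₀ : ℂ) (α : E → ℝ) :
    G.close.schwingerDensity D (closeExponents β₀ β) (fun o => o.elim 1 α) =
      (Complex.Gamma β₀)⁻¹ * ((∏ e, (α e : ℂ) ^ (β e - 1) / Complex.Gamma (β e)) *
        ((G.firstSymanzik α + G.secondSymanzik (twoPointInvariants 1) α : ℝ) : ℂ) ^ (-(D / 2))) := by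
  rw [schwingerDensity, firstSymanzik_close, Fintype.prod_option]
  simp [closeExponents, mul_assoc]

/-- Integration over `p²` of `(p²)^{D/2 - 1} exp(-p²)` times the Schwinger integrand replaces `U` by
`U + V`, the first Symanzik polynomial of the closed graph at `α₀ = 1`. -/
lemma integral_gamma_schwingerIntegrand [Finite V] [Fintype E] {G : FeynmanGraph V E (Fin 2)}
    (hG : G.IsConnected) {D : ℂ} (hD : 0 < D.re) (β : E → ℂ) {β₀ : ℂ} (hβ₀ : 0 < β₀.re)
    {α : E → ℝ} (hα : ∀ e, 0 < α e) :
    ∫ s in Set.Ioi (0 : ℝ), (Real.exp (-s) : ℂ) * (s : ℂ) ^ (D / 2 - 1) *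
        G.schwingerIntegrand D β (twoPointInvariants s) α =
      Complex.Gamma (D / 2) * Complex.Gamma β₀ *
        G.close.schwingerDensity D (closeExponents β₀ β) (fun o => o.elim 1 α) := by
  have hU := hG.firstSymanzik_pos hα
  have hV := G.secondSymanzik_twoPoint_nonneg hα
  set u := G.firstSymanzik α with hu
  set v := G.secondSymanzik (twoPointInvariants 1) α with hv
  have hr : 0 < 1 + v / u := by positivity
  have hD2 : 0 < (D / 2).re := by
    rw [Complex.div_ofNat_re]; positivity
  have hΓ : Complex.Gamma β₀ ≠ 0 := Complex.Gamma_ne_zero_of_re_pos hβ₀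
  have h1 : ∀ s : ℝ, (Real.exp (-s) : ℂ) * (s : ℂ) ^ (D / 2 - 1) *
      G.schwingerIntegrand D β (twoPointInvariants s) α =
      G.schwingerDensity D β α *
        ((s : ℂ) ^ (D / 2 - 1) * Complex.exp (-(((1 + v / u : ℝ) : ℂ) * s))) := by
    intro s
    have : Complex.exp (-(((1 + v / u : ℝ) : ℂ) * s)) =
        (Real.exp (-s) : ℂ) * Complex.exp (-((s * (v / u) : ℝ) : ℂ)) := by
      rw [Complex.ofReal_exp, ← Complex.exp_add]
      congr 1
      push_cast
      ring
    rw [schwingerIntegrand_eq, this]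
    ring
  simp_rw [h1]
  rw [integral_const_mul, Complex.integral_cpow_mul_exp_neg_mul_Ioi hD2 (by simpa using hr),
    schwingerDensity_close_one, schwingerDensity, ← hu, ← hv]
  have h2 : ((u + v : ℝ) : ℂ) ^ (-(D / 2)) =
      (u : ℂ) ^ (-(D / 2)) * (1 / ((1 + v / u : ℝ) : ℂ)) ^ (D / 2) := by
    have : u + v = u * (1 + v / u) := by field_simp
    rw [this, Complex.ofReal_mul, Complex.mul_cpow_ofReal_nonneg hU.le hr.le, one_div,
      ← Complex.ofReal_inv, Complex.cpow_neg (((1 + v / u : ℝ)) : ℂ), Complex.ofReal_inv,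
      Complex.inv_cpow _ _ ?_]
    rw [Complex.arg_ofReal_of_nonneg hr.le]
    exact Real.pi_pos.ne
  rw [h2]
  field_simp

/-- The kernel of the double integral over `p²` and the Schwinger parameters is absolutely
integrable: by scaling, the inner integral of its absolute value is a multiple of
`exp(-s) s^{Re β₀ - 1}`. -/
lemma integrable_gamma_schwingerIntegrand [Fintype V] [Fintype E]
    {G : FeynmanGraph V E (Fin 2)} (hG : G.IsConnected) {D : ℂ} {β : E → ℂ} {β₀ : ℂ}
    (hβ₀ : 0 < β₀.re)
    (hconv : ∀ p2 : ℝ, 0 < p2 → G.IntegralConverges D β (twoPointInvariants p2))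
    (hscale : G.close.IsScaleInvariant D (closeExponents β₀ β)) :
    Integrable (fun p : ℝ × (E → ℝ) => (Real.exp (-p.1) : ℂ) * (p.1 : ℂ) ^ (D / 2 - 1) *
        G.schwingerIntegrand D β (twoPointInvariants p.1) p.2)
      ((volume.restrict (Set.Ioi 0)).prod (volume.restrict {α : E → ℝ | ∀ e, 0 < α e})) := by
  have hmeas : Measurable fun p : ℝ × (E → ℝ) =>
      (Real.exp (-p.1) : ℂ) * (p.1 : ℂ) ^ (D / 2 - 1) *
        G.schwingerIntegrand D β (twoPointInvariants p.1) p.2 := by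
    have h1 := G.continuous_firstSymanzik.measurable
    have h2 := (G.continuous_secondSymanzik (twoPointInvariants 1)).measurable
    have h3 := G.measurable_schwingerDensity D β
    simp only [schwingerIntegrand_eq]
    fun_prop
  rw [integrable_prod_iff hmeas.aestronglyMeasurable]
  constructor
  · filter_upwards [ae_restrict_mem measurableSet_Ioi] with s hs
    exact (hconv s hs).const_mul _
  · have h := (Real.GammaIntegral_convergent hβ₀).mul_const
      (∫ α in {α : E → ℝ | ∀ e, 0 < α e}, ‖G.schwingerIntegrand D β (twoPointInvariants 1) α‖)
    refine IntegrableOn.congr_fun h (fun s (hs : 0 < s) => ?_) measurableSet_Ioi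
    simp only [norm_mul]
    rw [integral_const_mul, integral_norm_twoPoint hG D β hs, ← Complex.neg_re,
      ← (G.isScaleInvariant_close_iff D β β₀).1 hscale, Complex.norm_real,
      Real.norm_of_nonneg (Real.exp_pos _).le, Complex.norm_cpow_eq_rpow_re_of_pos hs,
      ← mul_assoc, mul_assoc (Real.exp _) (s ^ (D / 2 - 1).re), ← Real.rpow_add hs]
    congr 3
    simp only [Complex.sub_re, Complex.one_re]
    ring

lemma integrableOn_schwingerDensity_close_one [Fintype V] [Fintype E]
    {G : FeynmanGraph V E (Fin 2)} (hG : G.IsConnected) {D : ℂ} (hD : 0 < D.re) {β : E → ℂ}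
    {β₀ : ℂ} (hβ₀ : 0 < β₀.re)
    (hconv : ∀ p2 : ℝ, 0 < p2 → G.IntegralConverges D β (twoPointInvariants p2))
    (hscale : G.close.IsScaleInvariant D (closeExponents β₀ β)) :
    IntegrableOn (fun α : E → ℝ => G.close.schwingerDensity D (closeExponents β₀ β)
      (fun o => o.elim 1 α)) {α | ∀ e, 0 < α e} := by
  have h := (integrable_gamma_schwingerIntegrand hG hβ₀ hconv hscale).integral_prod_right
  have hD2 : 0 < (D / 2).re := by
    rw [Complex.div_ofNat_re]; positivity
  have hΓ : IsUnit (Complex.Gamma (D / 2) * Complex.Gamma β₀) := IsUnit.mk0 _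
    (mul_ne_zero (Complex.Gamma_ne_zero_of_re_pos hD2) (Complex.Gamma_ne_zero_of_re_pos hβ₀))
  refine (integrable_const_mul_iff hΓ _).1 ?_
  exact IntegrableOn.congr_fun h
    (fun α hα => integral_gamma_schwingerIntegrand hG hD β hβ₀ hα) measurableSet_orthant

/-- The double integral over `p²` and the Schwinger parameters, evaluated in both orders. -/
lemma eq_gamma_mul_integral_close_one [Fintype V] [Fintype E]
    {G : FeynmanGraph V E (Fin 2)} (hG : G.IsConnected) {D : ℂ} (hD : 0 < D.re) {β : E → ℂ}
    {β₀ N : ℂ} (hβ₀ : 0 < β₀.re)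
    (hconv : ∀ p2 : ℝ, 0 < p2 → G.IntegralConverges D β (twoPointInvariants p2))
    (hN : ∀ p2 : ℝ, 0 < p2 → G.twoPointIntegral D β p2 = (p2 : ℂ) ^ (β₀ - D / 2) * N)
    (hscale : G.close.IsScaleInvariant D (closeExponents β₀ β)) :
    N = Complex.Gamma (D / 2) * ∫ α in {α : E → ℝ | ∀ e, 0 < α e},
      G.close.schwingerDensity D (closeExponents β₀ β) (fun o => o.elim 1 α) := by
  have hswap := integral_integral_swap
    (f := fun (s : ℝ) (α : E → ℝ) => (Real.exp (-s) : ℂ) * (s : ℂ) ^ (D / 2 - 1) *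
        G.schwingerIntegrand D β (twoPointInvariants s) α)
    (integrable_gamma_schwingerIntegrand hG hβ₀ hconv hscale)
  have hleft : ∀ s ∈ Set.Ioi (0 : ℝ), ∫ α in {α : E → ℝ | ∀ e, 0 < α e},
      (Real.exp (-s) : ℂ) * (s : ℂ) ^ (D / 2 - 1) *
        G.schwingerIntegrand D β (twoPointInvariants s) α =
      (Real.exp (-s) : ℂ) * (s : ℂ) ^ (β₀ - 1) * N := by
    intro s (hs : 0 < s)
    have h : ∫ α in {α : E → ℝ | ∀ e, 0 < α e},
        G.schwingerIntegrand D β (twoPointInvariants s) α = _ := hN s hs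
    rw [integral_const_mul, h, ← mul_assoc, mul_assoc (Real.exp (-s) : ℂ),
      ← Complex.cpow_add _ _ (by exact_mod_cast hs.ne')]
    ring_nf
  rw [setIntegral_congr_fun measurableSet_Ioi hleft, integral_mul_const,
    setIntegral_congr_fun measurableSet_orthant
      fun α hα => integral_gamma_schwingerIntegrand hG hD β hβ₀ hα, integral_const_mul,
    mul_comm (Complex.Gamma (D / 2)), mul_assoc] at hswap
  have hΓ : ∫ s in Set.Ioi (0 : ℝ), (Real.exp (-s) : ℂ) * (s : ℂ) ^ (β₀ - 1) =
      Complex.Gamma β₀ := (Complex.Gamma_eq_integral hβ₀).symm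
  rw [hΓ] at hswap
  exact mul_left_cancel₀ (Complex.Gamma_ne_zero_of_re_pos hβ₀) hswap

/-- The edges of a graph as the edges of its closure other than the new one. -/
def someEquiv (E : Type*) : E ≃ {o : Option E // o ≠ none} where
  toFun e := ⟨some e, Option.some_ne_none e⟩
  invFun o := o.1.get (Option.ne_none_iff_isSome.1 o.2)
  left_inv _ := rfl
  right_inv o := by simp

section

variable [Fintype E] [DecidableEq E]

/-- For `J = {none}` the delta function sets the parameter of the new edge to `1`. -/
lemma deltaPoint_none (α : E → ℝ) :
    deltaPoint {none} none (MeasurableEquiv.piCongrLeft (fun _ => ℝ) (someEquiv E) α) =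
      fun o => o.elim 1 α := by
  ext (_ | e)
  · simp only [deltaPoint, dif_pos, Option.elim]
    rw [Finset.sum_eq_zero, sub_zero]
    exact fun o _ => if_neg (by simpa using o.2)
  · simp only [deltaPoint, reduceCtorEq, dif_neg, not_false_eq_true, Option.elim]
    exact Equiv.piCongrLeft_apply_apply (fun _ => ℝ) (someEquiv E) α e

lemma preimage_deltaPoint_none_pos :
    MeasurableEquiv.piCongrLeft (fun _ => ℝ) (someEquiv E) ⁻¹'
      {x | ∀ o, 0 < deltaPoint {none} none x o} = {α | ∀ e, 0 < α e} := by
  ext α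
  simp only [Set.mem_preimage, Set.mem_ofPred_eq, deltaPoint_none, Option.forall, Option.elim,
    zero_lt_one, true_and]

lemma integrableOn_deltaPoint_none_iff (f : (Option E → ℝ) → ℂ) :
    IntegrableOn (fun x => f (deltaPoint {none} none x))
        {x | ∀ o, 0 < deltaPoint {none} none x o} ↔
      IntegrableOn (fun α : E → ℝ => f (fun o => o.elim 1 α)) {α | ∀ e, 0 < α e} := by
  have h := (volume_measurePreserving_piCongrLeft (fun _ => ℝ)
    (someEquiv E)).integrableOn_comp_preimage
    (MeasurableEquiv.piCongrLeft (fun _ => ℝ) (someEquiv E)).measurableEmbedding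
    (f := fun x => f (deltaPoint {none} none x)) (s := {x | ∀ o, 0 < deltaPoint {none} none x o})
  rw [preimage_deltaPoint_none_pos] at h
  rw [← h]
  simp only [Function.comp_def, deltaPoint_none]

lemma setIntegral_deltaPoint_none (f : (Option E → ℝ) → ℂ) :
    ∫ x in {x | ∀ o, 0 < deltaPoint {none} none x o}, f (deltaPoint {none} none x) =
      ∫ α in {α : E → ℝ | ∀ e, 0 < α e}, f (fun o => o.elim 1 α) := by
  have h := (volume_measurePreserving_piCongrLeft (fun _ => ℝ)
    (someEquiv E)).setIntegral_preimage_emb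
    (MeasurableEquiv.piCongrLeft (fun _ => ℝ) (someEquiv E)).measurableEmbedding
    (fun x => f (deltaPoint {none} none x)) {x | ∀ o, 0 < deltaPoint {none} none x o}
  rw [preimage_deltaPoint_none_pos] at h
  rw [← h]
  simp only [deltaPoint_none]

end

end FeynmanGraph

theorem mainTheorem9 {V E : Type*} [Fintype V] [Fintype E] [DecidableEq E]
    (G : FeynmanGraph V E (Fin 2)) (hG : G.IsConnected)
    (D : ℂ) (β : E → ℂ) (β₀ N : ℂ)
    (hD : 0 < D.re) (hβ : ∀ e, 0 < (β e).re) (hβ₀ : 0 < β₀.re)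
    (hconv : ∀ p2 : ℝ, 0 < p2 →
      G.IntegralConverges D β (FeynmanGraph.twoPointInvariants p2))
    (hN : ∀ p2 : ℝ, 0 < p2 → G.twoPointIntegral D β p2 = (p2 : ℂ) ^ (β₀ - D / 2) * N)
    (hdet : N ≠ 0 ∨ G.close.IsScaleInvariant D (FeynmanGraph.closeExponents β₀ β)) :
    ∀ J : Finset (Option E), ∀ j ∈ J,
      G.close.ReducedIntegralConverges D (FeynmanGraph.closeExponents β₀ β)
          FeynmanGraph.noInvariants J j ∧
        N = Complex.Gamma (D / 2) *
          G.close.reducedIntegral D (FeynmanGraph.closeExponents β₀ β)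
            FeynmanGraph.noInvariants J j := by
  intro J j hj
  have hscale : G.close.IsScaleInvariant D (FeynmanGraph.closeExponents β₀ β) :=
    hdet.elim (FeynmanGraph.isScaleInvariant_close hG hN) id
  have hmeas := G.close.measurable_schwingerDensity D (FeynmanGraph.closeExponents β₀ β)
  -- Scale invariance means that the density has degree `-n`, with `n` the number of edges.
  have hhom : ∀ t : ℝ, 0 < t → ∀ α : Option E → ℝ, (∀ o, 0 < α o) →
      G.close.schwingerDensity D (FeynmanGraph.closeExponents β₀ β) α =
        ((t ^ Fintype.card (Option E) : ℝ) : ℂ) *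
          G.close.schwingerDensity D (FeynmanGraph.closeExponents β₀ β) (t • α) := by
    intro t ht α hα
    have htc : (t : ℂ) ≠ 0 := by exact_mod_cast ht.ne'
    have hsum : ∑ o, FeynmanGraph.closeExponents β₀ β o = _ := hscale
    rw [FeynmanGraph.schwingerDensity_smul hG.close _ _ ht hα, hsum, sub_sub, add_comm,
      ← sub_sub, sub_self, zero_sub, Complex.cpow_neg, Complex.cpow_natCast, ← mul_assoc,
      Complex.ofReal_pow, mul_inv_cancel₀ (pow_ne_zero _ htc), one_mul]
  have h0 : (none : Option E) ∈ ({none} : Finset (Option E)) := Finset.mem_singleton_self _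
  have hint := (FeynmanGraph.integrableOn_deltaPoint_none_iff _).2
    (FeynmanGraph.integrableOn_schwingerDensity_close_one hG hD hβ₀ hconv hscale)
  unfold FeynmanGraph.ReducedIntegralConverges FeynmanGraph.reducedIntegral
  simp only [FeynmanGraph.schwingerIntegrand_noInvariants]
  refine ⟨FeynmanGraph.integrableOn_deltaPoint_congr hmeas hhom h0 hj hint, ?_⟩
  rw [← FeynmanGraph.setIntegral_deltaPoint_congr hmeas hhom h0 hj hint,
    FeynmanGraph.setIntegral_deltaPoint_none]
  exact FeynmanGraph.eq_gamma_mul_integral_close_one hG hD hβ₀ hconv hN hscale
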